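/- Let $n\ge 1$ be an integer, let $(\Omega,\mathcal A,\mathbb P)$ be a probability space with a filtration $\mathcal F=(\mathcal F_k)_{0\le k\le n-1}$, and let $V=(V_k)_{0\le k\le n-1}$ be an $\mathcal F$-adapted sequence of integrable real random variables. Let $Q_{\min},Q_{\max}$ be (deterministic) real numbers with $0\le Q_{\min}\le Q_{\max}\le n$. An admissible control is a sequence $q=(q_k)_{0\le k\le n-1}$ of $[0,1]$-valued random variables such that $q_k$ is $\mathcal F_k$-measurable for every $k$ and $\sum_{k=0}^{n-1}q_k\in[Q_{\min},Q_{\max}]$. The premium is $$P_0^n(Q_{\min},Q_{\max})=\operatorname{ess\,sup}\Big\{\mathbb E\Big(\sum_{k=0}^{n-1}q_kV_k\,\Big|\,\mathcal F_0\Big)\;:\; q \text{ an admissible control}\Big\},$$ and an admissible control $q^*$ is called optimal if $\mathbb E\big(\sum_{k=0}^{n-1}q^*_kV_k\,|\,\mathcal F_0\big)=P_0^n(Q_{\min},Q_{\max})$ a.s. If $Q_{\max}-Q_{\min}\in\{0,1,\dots,n\}$, then there exists an optimal control $q^*=(q^*_k)_{0\le k\le n-1}$ which is quasi-bang-bang in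 the following sense: for $\mathbb P$-almost every $\omega$ there is at most one index $k_0=k_0(\omega)\in\{0,\dots,n-1\}$ such that $q^*_{k_0}(\omega)\notin\{0,1\}$. -/

import Mathlib

open MeasureTheory

namespace SwingOption

/-- The set `T⁺(n)` of deterministic couples of global constraints `(Q_min, Q_max)`:
`0 ≤ Q_min ≤ Q_max ≤ n`. -/
def globalConstraints (n : ℕ) : Set (ℝ × ℝ) :=
  {Q | 0 ≤ Q.1 ∧ Q.1 ≤ Q.2 ∧ Q.2 ≤ (n : ℝ)}

variable {Ω : Type*} {mΩ : MeasurableSpace Ω}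

/-- `f` is (a version of) the essential supremum, with respect to `μ`, of the family `S` of
extended real valued functions: it is an almost sure upper bound of every element of `S` and it
is almost surely dominated by every other such upper bound. -/
def IsEssSup (μ : Measure Ω) (S : Set (Ω → EReal)) (f : Ω → EReal) : Prop :=
  AEMeasurable f μ ∧ (∀ g ∈ S, g ≤ᵐ[μ] f) ∧
    ∀ h : Ω → EReal, AEMeasurable h μ → (∀ g ∈ S, g ≤ᵐ[μ] h) → f ≤ᵐ[μ] h

/-- Locally admissible controls with maturity `n`: adapted and `[0,1]`-valued sequences
`(q k)`, `k = 0, …, n - 1` (the values `q k` for `k ≥ n` play no role). -/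
def IsLocallyAdmissible (n : ℕ) (F : Filtration ℕ mΩ) (q : ℕ → Ω → ℝ) : Prop :=
  ∀ k < n, Measurable[F k] (q k) ∧ ∀ ω, q k ω ∈ Set.Icc (0 : ℝ) 1

/-- `(F, Q)`-admissible controls: locally admissible controls whose cumulative purchase
`q 0 + ⋯ + q (n - 1)` lies in `[Q_min, Q_max]`. -/
def IsAdmissible (n : ℕ) (F : Filtration ℕ mΩ) (Q : ℝ × ℝ) (q : ℕ → Ω → ℝ) : Prop :=
  IsLocallyAdmissible n F q ∧ ∀ ω, ∑ k ∈ Finset.range n, q k ω ∈ Set.Icc Q.1 Q.2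

/-- The expected gain `𝔼(∑_{k < n} q k * V k | F 0)` of the control `q`. -/
noncomputable def gain (μ : Measure Ω) (n : ℕ) (F : Filtration ℕ mΩ) (V q : ℕ → Ω → ℝ) :
    Ω → ℝ :=
  μ[fun ω => ∑ k ∈ Finset.range n, q k ω * V k ω | F 0]

/-- `P` is (a version of) the premium `P₀ⁿ(Q, (V, F))` of the swing option, i.e. the essential
supremum of the expected gains of the `(F, Q)`-admissible controls. -/
def IsPremium (μ : Measure Ω) (n : ℕ) (F : Filtration ℕ mΩ) (V : ℕ → Ω → ℝ) (Q : ℝ × ℝ)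
    (P : Ω → EReal) : Prop :=
  IsEssSup μ {g | ∃ q, IsAdmissible n F Q q ∧ g = fun ω => (gain μ n F V q ω : EReal)} P

/-- Optimal controls: admissible controls whose expected gain is the premium. -/
def IsOptimal (μ : Measure Ω) (n : ℕ) (F : Filtration ℕ mΩ) (V : ℕ → Ω → ℝ) (Q : ℝ × ℝ)
    (q : ℕ → Ω → ℝ) : Prop :=
  IsAdmissible n F Q q ∧ IsPremium μ n F V Q (fun ω => (gain μ n F V q ω : EReal))

/-- Quasi-bang-bang controls: almost surely, there is at most one date `k < n` (which may depend
on the scenario `ω`) at which the control takes a value outside `{0, 1}`. -/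
def IsQuasiBangBang (μ : Measure Ω) (n : ℕ) (q : ℕ → Ω → ℝ) : Prop :=
  ∀ᵐ ω ∂μ, {k : ℕ | k < n ∧ q k ω ∉ ({0, 1} : Set ℝ)}.Subsingleton

end SwingOption

/-!
The optimal control comes from backward dynamic programming at integer constraints, extended
to real constraints by linear interpolation.

Write `m` for the integer `Q_max - Q_min`. Since the width of the constraint interval does not
change when something is bought, the state at a date is the residual lower constraint `x`, the
residual upper constraint being `x + m`; with `N` dates left, `x` is feasible iff `-m ≤ x ≤ N`, an
interval with integer endpoints. At integer states one buys `0` or `1`, whichever is better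
(`purchase`), and this defines the value functions (`value`). They are almost surely concave on
the feasible integers (`ae_concaveOnFeasible_value`).

At a real state `x = a + t`, with `a` an integer and `0 ≤ t < 1`, the value is taken to be the
affine interpolation of the values at `a` and `a + 1`, and the purchase (`feedback`) the
interpolation of the integer purchases.

* *Upper bound.* The interpolated value dominates the outcome of every purchase in `[0, 1]`
  (`mul_add_interp_le`). Hence accumulated gain plus value of the residual state is a
  supermartingale for every admissible control (`IsAdmissible.gain_le`).
* *Attainment.* By concavity the integer purchase is nondecreasing in the state
  (`ConcaveOnFeasible.purchase_le`). So the states `a` and `a + 1` either make the same purchase,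
  or only `a + 1` buys; in both cases the interpolated purchase leads to equality in the upper
  bound (`ConcaveOnFeasible.feedback_mul_add_interp`), and the process above is a martingale.
* *Shape.* In the first case the purchase is `0` or `1`. In the second it is `t`, and the new state
  is the integer `a`; from then on all states are integers and all purchases `0` or `1`
  (`isQuasiBangBang_optControl`).
-/

namespace SwingOption

/-! ### Interpolation of functions on the integers -/

/-- The continuous function on `ℝ` that agrees with `h` on `ℤ` and is affine on every interval
`[c, c + 1]` with `c : ℤ`. -/
noncomputable def interp (h : ℤ → ℝ) (x : ℝ) : ℝ :=
  (1 - Int.fract x) * h ⌊x⌋ + Int.fract x * h (⌊x⌋ + 1)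

theorem interp_intCast_add (h : ℤ → ℝ) (a : ℤ) {t : ℝ} (ht0 : 0 ≤ t) (ht1 : t ≤ 1) :
    interp h (a + t) = (1 - t) * h a + t * h (a + 1) := by
  rcases ht1.lt_or_eq with ht1 | rfl
  · have hf : ⌊(a : ℝ) + t⌋ = a := by
      rw [Int.floor_intCast_add, Int.floor_eq_zero_iff.2 ⟨ht0, ht1⟩, add_zero]
    have hr : Int.fract ((a : ℝ) + t) = t := by
      rw [Int.fract_intCast_add, Int.fract_eq_self.2 ⟨ht0, ht1⟩]
    rw [interp, hf, hr]
  · have hf : ⌊(a : ℝ) + 1⌋ = a + 1 := by simp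
    have hr : Int.fract ((a : ℝ) + 1) = 0 := by simp
    rw [interp, hf, hr]; ring

theorem interp_intCast (h : ℤ → ℝ) (a : ℤ) : interp h a = h a := by
  simp [interp]

theorem exists_eq_intCast_add (x : ℝ) : ∃ (a : ℤ) (t : ℝ), 0 ≤ t ∧ t < 1 ∧ x = a + t :=
  ⟨⌊x⌋, Int.fract x, Int.fract_nonneg x, Int.fract_lt_one x, (Int.floor_add_fract x).symm⟩

/-- On a bounded interval, `interp h` is a finite combination of the values of `h`, whose
coefficients are the tent functions `interp (Pi.single c 1)`. -/
theorem interp_eq_sum (h : ℤ → ℝ) {A B : ℤ} {x : ℝ} (hA : (A : ℝ) ≤ x) (hB : x ≤ B) :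
    interp h x = ∑ c ∈ Finset.Icc A (B + 1), interp (Pi.single c 1) x * h c := by
  have h1 : A ≤ ⌊x⌋ := Int.le_floor.2 hA
  have h2 : ⌊x⌋ ≤ B := by exact_mod_cast (Int.floor_le x).trans hB
  have m1 : ⌊x⌋ ∈ Finset.Icc A (B + 1) := Finset.mem_Icc.2 ⟨h1, by lia⟩
  have m2 : ⌊x⌋ + 1 ∈ Finset.Icc A (B + 1) := Finset.mem_Icc.2 ⟨by lia, by lia⟩
  simp only [interp, Pi.single_apply, add_mul, Finset.sum_add_distrib, mul_ite, ite_mul, mul_one,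
    mul_zero, zero_mul, Finset.sum_ite_eq, m1, m2, if_true]

theorem measurable_interp_const (h : ℤ → ℝ) : Measurable (interp h) := by
  unfold interp
  have hh : Measurable h := measurable_from_top
  fun_prop

theorem interp_single_mem_Icc (c : ℤ) (x : ℝ) :
    interp (Pi.single c 1) x ∈ Set.Icc (0 : ℝ) 1 := by
  have h0 := Int.fract_nonneg x
  have h1 := (Int.fract_lt_one x).le
  simp only [interp, Pi.single_apply]
  constructor <;> split_ifs <;> first | lia | linarith

/-! ### One step of the dynamic programming recursion -/

/-- The quantity, `0` or `1`, to buy at a date after which `N` dates remain, when the residual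
lower constraint is the integer `c` (and the residual upper constraint is `c + m`), the spot gain
is `v`, and `f` is the continuation value as a function of the new residual constraint. Buying is
forced if `N + 1 ≤ c` and forbidden if `c ≤ -m`, so that feasible constraints stay feasible. -/
noncomputable def purchase (m N : ℕ) (v : ℝ) (f : ℤ → ℝ) (c : ℤ) : ℤ :=
  if (N : ℤ) + 1 ≤ c then 1 else if c ≤ -(m : ℤ) then 0
    else if f c ≤ v + f (c - 1) then 1 else 0

/-- The value obtained by following `purchase` at the current date. -/
noncomputable def stepValue (m N : ℕ) (v : ℝ) (f : ℤ → ℝ) (c : ℤ) : ℝ :=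
  purchase m N v f c * v + f (c - purchase m N v f c)

/-- Concavity on the integers of `[-m, N]`, which are the feasible residual lower constraints
when `N` dates remain. -/
def ConcaveOnFeasible (m N : ℕ) (f : ℤ → ℝ) : Prop :=
  ∀ c : ℤ, -(m : ℤ) < c → c < N → f (c - 1) + f (c + 1) ≤ 2 * f c

variable {m N : ℕ} {v : ℝ} {f : ℤ → ℝ}

theorem purchase_eq_zero_or_one (m N : ℕ) (v : ℝ) (f : ℤ → ℝ) (c : ℤ) :
    purchase m N v f c = 0 ∨ purchase m N v f c = 1 := by
  unfold purchase; split_ifs <;> simp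

theorem sub_purchase_mem {c : ℤ} (h1 : -(m : ℤ) ≤ c) (h2 : c ≤ N + 1) :
    -(m : ℤ) ≤ c - purchase m N v f c ∧ c - purchase m N v f c ≤ N := by
  unfold purchase; split_ifs <;> lia

theorem le_stepValue {c : ℤ} (h1 : -(m : ℤ) ≤ c) (h2 : c ≤ N) : f c ≤ stepValue m N v f c := by
  rcases h1.eq_or_lt with h | h
  · have : purchase m N v f c = 0 := by
      rw [purchase, if_neg (by lia), if_pos (by lia)]
    simp [stepValue, this]
  · by_cases h3 : f c ≤ v + f (c - 1)
    · have : purchase m N v f c = 1 := by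
        rw [purchase, if_neg (by lia), if_neg (by lia), if_pos h3]
      simpa [stepValue, this] using h3
    · have : purchase m N v f c = 0 := by
        rw [purchase, if_neg (by lia), if_neg (by lia), if_neg h3]
      simp [stepValue, this]

theorem add_le_stepValue {c : ℤ} (h1 : -(m : ℤ) ≤ c) (h2 : c ≤ N) :
    v + f c ≤ stepValue m N v f (c + 1) := by
  rcases h2.eq_or_lt with h | h
  · have : purchase m N v f (c + 1) = 1 := by
      rw [purchase, if_pos (by lia)]
    simp [stepValue, this]
  · by_cases h3 : f (c + 1) ≤ v + f (c + 1 - 1)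
    · have : purchase m N v f (c + 1) = 1 := by
        rw [purchase, if_neg (by lia), if_neg (by lia), if_pos h3]
      simp [stepValue, this]
    · have : purchase m N v f (c + 1) = 0 := by
        rw [purchase, if_neg (by lia), if_neg (by lia), if_neg h3]
      rw [add_sub_cancel_right] at h3
      simpa [stepValue, this] using (not_le.1 h3).le

theorem ConcaveOnFeasible.stepValue (hf : ConcaveOnFeasible m N f) :
    ConcaveOnFeasible m (N + 1) (stepValue m N v f) := by
  intro c hc1 hc2
  push_cast at hc2
  have g0 := le_stepValue (v := v) (f := f) hc1.le (by lia : c ≤ N)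
  have g1 := add_le_stepValue (v := v) (f := f) (by lia : -(m : ℤ) ≤ c - 1) (by lia : c - 1 ≤ N)
  rw [sub_add_cancel] at g1
  obtain ⟨l1, l2⟩ := sub_purchase_mem (v := v) (f := f) (by lia : -(m : ℤ) ≤ c - 1)
    (by lia : c - 1 ≤ N + 1)
  obtain ⟨r1, r2⟩ := sub_purchase_mem (v := v) (f := f) (by lia : -(m : ℤ) ≤ c + 1)
    (by lia : c + 1 ≤ N + 1)
  rw [SwingOption.stepValue, SwingOption.stepValue]
  rcases purchase_eq_zero_or_one m N v f (c - 1) with h | h <;>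
  rcases purchase_eq_zero_or_one m N v f (c + 1) with h' | h' <;>
  simp only [h, h', Int.cast_zero, Int.cast_one, zero_mul, one_mul, zero_add, sub_zero,
    add_sub_cancel_right] at l1 l2 r1 r2 ⊢
  · linarith [hf c hc1 (by lia)]
  · linarith
  · have e1 := hf (c - 1) (by lia) (by lia)
    rw [sub_add_cancel] at e1
    linarith [hf c hc1 (by lia)]
  · have e1 := hf (c - 1) (by lia) (by lia)
    rw [sub_add_cancel] at e1
    linarith

/-- Concavity of the continuation value makes the purchase nondecreasing in the residual
constraint: the more remains to be bought, the more is bought now. -/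
theorem ConcaveOnFeasible.purchase_le (hf : ConcaveOnFeasible m N f) {c : ℤ} (h2 : c ≤ N) :
    purchase m N v f c ≤ purchase m N v f (c + 1) := by
  rcases purchase_eq_zero_or_one m N v f (c + 1) with h' | h'
  · rw [h']
    unfold purchase at h' ⊢
    split_ifs at h' ⊢
    all_goals try lia
    have := hf c (by lia) (by lia)
    rw [add_sub_cancel_right] at *
    linarith
  · rw [h']
    rcases purchase_eq_zero_or_one m N v f c with h | h <;> rw [h] <;> norm_num

/-- The optimality inequality for real residual constraints: no purchase `q` in `[0, 1]` that
leaves the constraints feasible does better than the interpolated value. -/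
theorem mul_add_interp_le {x q : ℝ} (hq0 : 0 ≤ q) (hq1 : q ≤ 1) (h1 : -(m : ℝ) ≤ x - q)
    (h2 : x - q ≤ N) : q * v + interp f (x - q) ≤ interp (stepValue m N v f) x := by
  obtain ⟨a, t, ht0, ht1, rfl⟩ := exists_eq_intCast_add x
  rw [interp_intCast_add _ a ht0 ht1.le]
  rcases le_or_gt q t with hqt | hqt
  · rw [add_sub_assoc] at h1 h2 ⊢
    rw [interp_intCast_add _ a (by linarith) (by linarith)]
    have ha1 : -(m : ℤ) ≤ a := by
      have : (-(m : ℤ) : ℝ) < (a + 1 : ℤ) := by push_cast; linarith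
      have : -(m : ℤ) < a + 1 := by exact_mod_cast this
      lia
    have ha2 : a ≤ N := by
      have : (a : ℝ) ≤ N := by linarith
      exact_mod_cast this
    -- if `a + 1` is infeasible, then `q = t` and `f (a + 1)` has weight zero
    have e : (t - q) * f (a + 1) ≤ (t - q) * stepValue m N v f (a + 1) := by
      rcases hqt.eq_or_lt with rfl | hlt
      · simp
      · have : (a : ℝ) < (N : ℤ) := by push_cast; linarith
        have : a < (N : ℤ) := by exact_mod_cast this
        exact mul_le_mul_of_nonneg_left (le_stepValue (by lia) (by lia)) (by linarith)
    have e1 := mul_le_mul_of_nonneg_left (le_stepValue (v := v) (f := f) ha1 ha2)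
      (by linarith : 0 ≤ 1 - t)
    have e2 := mul_le_mul_of_nonneg_left (add_le_stepValue (v := v) (f := f) ha1 ha2) hq0
    linarith
  · have hx : (a : ℝ) + t - q = (a - 1 : ℤ) + (1 + t - q) := by push_cast; ring
    rw [hx] at h1 h2 ⊢
    rw [interp_intCast_add _ (a - 1) (by linarith) (by linarith), sub_add_cancel]
    push_cast at h1 h2
    have ha1 : -(m : ℤ) ≤ a - 1 := by
      have : (-(m : ℤ) : ℝ) < a := by push_cast; linarith
      have : -(m : ℤ) < a := by exact_mod_cast this
      lia
    have ha2 : a - 1 ≤ N := by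
      have : ((a - 1 : ℤ) : ℝ) ≤ (N : ℤ) := by push_cast; linarith
      exact_mod_cast this
    have e := mul_le_mul_of_nonneg_left (add_le_stepValue (v := v) (f := f) ha1 ha2)
      (by linarith : 0 ≤ q - t)
    rw [sub_add_cancel] at e
    rcases (by linarith : 0 ≤ 1 + t - q).eq_or_lt with h0 | h0
    · have ht : t = 0 := by linarith
      have hq : q = 1 := by linarith
      subst ht hq
      linarith
    · have : (a : ℝ) < (N + 1 : ℤ) := by push_cast; linarith
      have : a < (N : ℤ) + 1 := by exact_mod_cast this
      have e1 := mul_le_mul_of_nonneg_left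
        (le_stepValue (v := v) (f := f) (by lia : -(m : ℤ) ≤ a) (by lia : a ≤ N))
        (by linarith : 0 ≤ 1 - q)
      have e2 := mul_le_mul_of_nonneg_left
        (add_le_stepValue (v := v) (f := f) (by lia : -(m : ℤ) ≤ a) (by lia : a ≤ N)) ht0
      linarith

/-- The feedback purchase at a real residual constraint: the interpolation of the integer
purchases. -/
noncomputable def feedback (m N : ℕ) (v : ℝ) (f : ℤ → ℝ) (x : ℝ) : ℝ :=
  interp (fun c => (purchase m N v f c : ℝ)) x

theorem feedback_mem_Icc (x : ℝ) : feedback m N v f x ∈ Set.Icc (0 : ℝ) 1 := by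
  have h0 := Int.fract_nonneg x
  have h1 := (Int.fract_lt_one x).le
  simp only [feedback, interp]
  rcases purchase_eq_zero_or_one m N v f ⌊x⌋ with h | h <;>
  rcases purchase_eq_zero_or_one m N v f (⌊x⌋ + 1) with h' | h' <;>
  rw [h, h'] <;> constructor <;> push_cast <;> linarith

theorem sub_feedback_mem {x : ℝ} (h1 : -(m : ℝ) ≤ x) (h2 : x ≤ N + 1) :
    -(m : ℝ) ≤ x - feedback m N v f x ∧ x - feedback m N v f x ≤ N := by
  obtain ⟨a, t, ht0, ht1, rfl⟩ := exists_eq_intCast_add x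
  rw [feedback, interp_intCast_add _ a ht0 ht1.le]
  have ha1 : -(m : ℤ) ≤ a := by
    have : (-(m : ℤ) : ℝ) < (a + 1 : ℤ) := by push_cast; linarith
    have : -(m : ℤ) < a + 1 := by exact_mod_cast this
    lia
  have ha2 : a ≤ N + 1 := by
    have : (a : ℝ) ≤ (N + 1 : ℤ) := by push_cast; linarith
    exact_mod_cast this
  obtain ⟨b1, b2⟩ := sub_purchase_mem (v := v) (f := f) ha1 ha2
  have c1 : -(m : ℝ) ≤ a - purchase m N v f a := by exact_mod_cast b1
  have c2 : (a : ℝ) - purchase m N v f a ≤ N := by exact_mod_cast b2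
  rcases ht0.eq_or_lt with rfl | ht
  · constructor <;> linarith
  · have ha3 : a + 1 ≤ N + 1 := by
      have : (a : ℝ) < (N + 1 : ℤ) := by push_cast; linarith
      have : a < (N : ℤ) + 1 := by exact_mod_cast this
      lia
    obtain ⟨b1, b2⟩ := sub_purchase_mem (v := v) (f := f) (by lia : -(m : ℤ) ≤ a + 1) ha3
    have d1 : -(m : ℝ) ≤ a + 1 - purchase m N v f (a + 1) := by exact_mod_cast b1
    have d2 : (a : ℝ) + 1 - purchase m N v f (a + 1) ≤ N := by exact_mod_cast b2
    constructor <;> nlinarith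

/-- The two cases of a feedback purchase: at `x = a + t`, either both integer neighbours make the
same purchase `d`, or only the upper one buys, and then the new residual constraint is the
integer `a`. -/
theorem ConcaveOnFeasible.feedback_cases (hf : ConcaveOnFeasible m N f) {a : ℤ} {t : ℝ}
    (ht0 : 0 < t) (ht1 : t < 1) (h2 : (a : ℝ) + t ≤ N + 1) :
    (∃ d : ℤ, (d = 0 ∨ d = 1) ∧ purchase m N v f a = d ∧ purchase m N v f (a + 1) = d ∧
        feedback m N v f (a + t) = d) ∨
      (purchase m N v f a = 0 ∧ purchase m N v f (a + 1) = 1 ∧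
        feedback m N v f (a + t) = t) := by
  have ha : a ≤ N := by
    have : (a : ℝ) < (N + 1 : ℤ) := by push_cast; linarith
    have : a < (N : ℤ) + 1 := by exact_mod_cast this
    lia
  have hle := hf.purchase_le (v := v) ha
  rw [feedback, interp_intCast_add _ a ht0.le ht1.le]
  rcases purchase_eq_zero_or_one m N v f a with h | h <;>
  rcases purchase_eq_zero_or_one m N v f (a + 1) with h' | h'
  · exact Or.inl ⟨0, by simp [h, h']⟩
  · exact Or.inr (by simp [h, h'])
  · lia
  · exact Or.inl ⟨1, by simp [h, h']⟩

theorem feedback_intCast (a : ℤ) : feedback m N v f a = purchase m N v f a :=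
  interp_intCast _ _

/-- The feedback purchase attains equality in `mul_add_interp_le`. -/
theorem ConcaveOnFeasible.feedback_mul_add_interp (hf : ConcaveOnFeasible m N f) {x : ℝ}
    (h2 : x ≤ N + 1) :
    feedback m N v f x * v + interp f (x - feedback m N v f x) =
      interp (SwingOption.stepValue m N v f) x := by
  obtain ⟨a, t, ht0, ht1, rfl⟩ := exists_eq_intCast_add x
  rcases ht0.eq_or_lt with rfl | ht
  · rw [add_zero, feedback_intCast, interp_intCast, ← Int.cast_sub, interp_intCast,
      SwingOption.stepValue]
  · rw [interp_intCast_add _ a ht0 ht1.le, SwingOption.stepValue, SwingOption.stepValue]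
    rcases hf.feedback_cases (v := v) ht ht1 h2 with ⟨d, -, h, h', e⟩ | ⟨h, h', e⟩
    · have hx : (a : ℝ) + t - d = (a - d : ℤ) + t := by push_cast; ring
      rw [e, h, h', hx, interp_intCast_add _ _ ht0 ht1.le,
        (by ring : a - d + 1 = a + 1 - d)]
      ring
    · rw [e, h, h', add_sub_cancel_right, interp_intCast]
      simp
      ring

theorem exists_intCast_sub_feedback (a : ℤ) :
    ∃ b : ℤ, (a : ℝ) - feedback m N v f a = b :=
  ⟨a - purchase m N v f a, by rw [feedback_intCast]; push_cast; rfl⟩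

theorem feedback_intCast_mem (a : ℤ) : feedback m N v f a ∈ ({0, 1} : Set ℝ) := by
  rw [feedback_intCast]
  rcases purchase_eq_zero_or_one m N v f a with h | h <;> simp [h]

/-- A fractional feedback purchase brings the residual constraint to an integer. -/
theorem ConcaveOnFeasible.exists_intCast_of_feedback_notMem (hf : ConcaveOnFeasible m N f)
    {x : ℝ} (h2 : x ≤ N + 1) (hx : feedback m N v f x ∉ ({0, 1} : Set ℝ)) :
    ∃ b : ℤ, x - feedback m N v f x = b := by
  obtain ⟨a, t, ht0, ht1, rfl⟩ := exists_eq_intCast_add x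
  rcases ht0.eq_or_lt with rfl | ht
  · exact absurd (by simpa using feedback_intCast_mem a) hx
  · rcases hf.feedback_cases (v := v) ht ht1 h2 with ⟨d, hd, -, -, e⟩ | ⟨-, -, e⟩
    · rcases hd with rfl | rfl <;> simp [e] at hx
    · exact ⟨a, by rw [e, add_sub_cancel_right]⟩

/-! ### Interpolation of random functions -/

variable {Ω : Type*} {mΩ : MeasurableSpace Ω} {μ : Measure Ω}

theorem measurable_interp {m' : MeasurableSpace Ω} {h : ℤ → Ω → ℝ} {X : Ω → ℝ} {A B : ℤ}
    (hh : ∀ c, Measurable[m'] (h c)) (hX : Measurable[m'] X)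
    (hA : ∀ ω, (A : ℝ) ≤ X ω) (hB : ∀ ω, X ω ≤ B) :
    Measurable[m'] (fun ω => interp (fun c => h c ω) (X ω)) := by
  have : (fun ω => interp (fun c => h c ω) (X ω)) =
      fun ω => ∑ c ∈ Finset.Icc A (B + 1), interp (Pi.single c 1) (X ω) * h c ω := by
    funext ω; exact interp_eq_sum _ (hA ω) (hB ω)
  rw [this]
  exact Finset.measurable_fun_sum _ fun c _ =>
    ((measurable_interp_const _).comp hX).mul (hh c)

theorem integrable_tent_mul {h : Ω → ℝ} {X : Ω → ℝ} (c : ℤ)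
    (hh : Integrable h μ) (hX : Measurable X) :
    Integrable (fun ω => interp (Pi.single c 1) (X ω) * h ω) μ := by
  refine hh.bdd_mul (c := 1) ((measurable_interp_const _).comp hX).aestronglyMeasurable
    (Filter.Eventually.of_forall fun ω => ?_)
  obtain ⟨h0, h1⟩ := interp_single_mem_Icc c (X ω)
  rwa [Real.norm_of_nonneg h0]

theorem integrable_interp {h : ℤ → Ω → ℝ} {X : Ω → ℝ} {A B : ℤ}
    (hh : ∀ c, Integrable (h c) μ) (hX : Measurable X)
    (hA : ∀ ω, (A : ℝ) ≤ X ω) (hB : ∀ ω, X ω ≤ B) :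
    Integrable (fun ω => interp (fun c => h c ω) (X ω)) μ := by
  have : (fun ω => interp (fun c => h c ω) (X ω)) =
      fun ω => ∑ c ∈ Finset.Icc A (B + 1), interp (Pi.single c 1) (X ω) * h c ω := by
    funext ω; exact interp_eq_sum _ (hA ω) (hB ω)
  rw [this]
  exact integrable_finsetSum _ fun c _ => integrable_tent_mul c (hh c) hX

/-- Conditional expectation commutes with interpolation at a measurable bounded point. -/
theorem condExp_interp [IsFiniteMeasure μ] {m' : MeasurableSpace Ω} (hm : m' ≤ mΩ)
    {h : ℤ → Ω → ℝ} {X : Ω → ℝ} {A B : ℤ}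
    (hh : ∀ c, Integrable (h c) μ) (hX : Measurable[m'] X)
    (hA : ∀ ω, (A : ℝ) ≤ X ω) (hB : ∀ ω, X ω ≤ B) :
    μ[fun ω => interp (fun c => h c ω) (X ω) | m'] =ᵐ[μ]
      fun ω => interp (fun c => (μ[h c | m']) ω) (X ω) := by
  have e : (fun ω => interp (fun c => h c ω) (X ω)) =
      ∑ c ∈ Finset.Icc A (B + 1), (fun ω => interp (Pi.single c 1) (X ω) * h c ω) := by
    funext ω
    rw [Finset.sum_apply]
    exact interp_eq_sum _ (hA ω) (hB ω)
  have hX' : Measurable[mΩ] X := hX.mono hm le_rfl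
  rw [e]
  refine (condExp_finsetSum (fun c _ => integrable_tent_mul c (hh c) hX') m').trans ?_
  have hc : ∀ c, μ[fun ω => interp (Pi.single c 1) (X ω) * h c ω | m'] =ᵐ[μ]
      fun ω => interp (Pi.single c 1) (X ω) * (μ[h c | m']) ω := fun c =>
    condExp_mul_of_stronglyMeasurable_left
      ((measurable_interp_const _).comp hX).stronglyMeasurable
      (integrable_tent_mul c (hh c) hX') (hh c)
  filter_upwards [ae_all_iff.2 hc] with ω hω
  rw [Finset.sum_apply, interp_eq_sum _ (hA ω) (hB ω)]
  exact Finset.sum_congr rfl fun c _ => hω c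

/-! ### The value functions and the verification inequality -/

/-- The value function at integer residual constraints, indexed by the number `N` of remaining
dates: `value μ n F V m N c` is the optimal conditional expected gain from date `n - N` on, when
the remaining purchases have to sum up to a number in `[c, c + m]`. It is meaningful for
`-m ≤ c ≤ N`. -/
noncomputable def value (μ : Measure Ω) (n : ℕ) (F : Filtration ℕ mΩ) (V : ℕ → Ω → ℝ) (m : ℕ) :
    ℕ → ℤ → Ω → ℝ
  | 0, _ => 0
  | N + 1, c => fun ω => stepValue m N (V (n - (N + 1)) ω)
      (fun c' => (μ[value μ n F V m N c' | F (n - (N + 1))]) ω) c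

/-- The continuation value at date `k` as a function of the new residual constraint. -/
noncomputable def contValue (μ : Measure Ω) (n : ℕ) (F : Filtration ℕ mΩ) (V : ℕ → Ω → ℝ) (m : ℕ)
    (k : ℕ) (ω : Ω) (c : ℤ) : ℝ :=
  (μ[value μ n F V m (n - (k + 1)) c | F k]) ω

variable {n : ℕ} {F : Filtration ℕ mΩ} {V : ℕ → Ω → ℝ}

theorem value_sub {k : ℕ} (hk : k < n) (c : ℤ) (ω : Ω) :
    value μ n F V m (n - k) c ω =
      stepValue m (n - (k + 1)) (V k ω) (contValue μ n F V m k ω) c := by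
  have h1 : n - k = (n - (k + 1)) + 1 := by lia
  have h2 : n - (n - (k + 1) + 1) = k := by lia
  rw [h1, value, h2]
  rfl

theorem measurable_contValue (k : ℕ) (c : ℤ) :
    Measurable[F k] (fun ω => contValue μ n F V m k ω c) :=
  stronglyMeasurable_condExp.measurable

theorem measurable_purchase {m' : MeasurableSpace Ω} {v : Ω → ℝ} {f : Ω → ℤ → ℝ}
    (hv : Measurable[m'] v) (hf : ∀ c, Measurable[m'] (fun ω => f ω c)) (c : ℤ) :
    Measurable[m'] (fun ω => (purchase m N (v ω) (f ω) c : ℝ)) := by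
  unfold purchase
  split_ifs
  · exact measurable_const
  · exact measurable_const
  · have hs : MeasurableSet[m'] {ω | f ω c ≤ v ω + f ω (c - 1)} :=
      measurableSet_le (hf c) (hv.add (hf (c - 1)))
    simp only [apply_ite (Int.cast : ℤ → ℝ)]
    exact Measurable.ite hs measurable_const measurable_const

theorem integrable_stepValue {v : Ω → ℝ} {f : Ω → ℤ → ℝ} (hv : Integrable v μ)
    (hvm : Measurable v) (hfm : ∀ c, Measurable (fun ω => f ω c))
    (hf : ∀ c, Integrable (fun ω => f ω c) μ) (c : ℤ) :
    Integrable (fun ω => stepValue m N (v ω) (f ω) c) μ := by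
  have e : (fun ω => stepValue m N (v ω) (f ω) c) = fun ω =>
      (purchase m N (v ω) (f ω) c : ℝ) * (v ω + f ω (c - 1) - f ω c) + f ω c := by
    funext ω
    rw [stepValue]
    rcases purchase_eq_zero_or_one m N (v ω) (f ω) c with h | h <;> rw [h] <;> simp
  rw [e]
  refine Integrable.add ?_ (hf c)
  refine ((hv.add (hf (c - 1))).sub (hf c)).bdd_mul (c := 1)
    (measurable_purchase hvm hfm c).aestronglyMeasurable (Filter.Eventually.of_forall fun ω => ?_)
  rcases purchase_eq_zero_or_one m N (v ω) (f ω) c with h | h <;> rw [h] <;> simp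

theorem integrable_value [IsFiniteMeasure μ] (hVm : ∀ k < n, Measurable[F k] (V k))
    (hVi : ∀ k < n, Integrable (V k) μ) {N : ℕ} (hN : N ≤ n) (c : ℤ) :
    Integrable (value μ n F V m N c) μ := by
  cases N with
  | zero => exact integrable_zero _ _ _
  | succ N =>
    have hk : n - (N + 1) < n := by lia
    exact integrable_stepValue (hVi _ hk) ((hVm _ hk).mono (F.le _) le_rfl)
      (fun c' => stronglyMeasurable_condExp.measurable.mono (F.le _) le_rfl)
      (fun c' => integrable_condExp) c

theorem ae_concaveOnFeasible_condExp {N : ℕ} {h : ℤ → Ω → ℝ} {m' : MeasurableSpace Ω}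
    (hi : ∀ c, Integrable (h c) μ)
    (hh : ∀ᵐ ω ∂μ, ConcaveOnFeasible m N (fun c => h c ω)) :
    ∀ᵐ ω ∂μ, ConcaveOnFeasible m N (fun c => (μ[h c | m']) ω) := by
  have key : ∀ c : ℤ, -(m : ℤ) < c → c < N → ∀ᵐ ω ∂μ,
      (μ[h (c - 1) | m']) ω + (μ[h (c + 1) | m']) ω ≤ 2 * (μ[h c | m']) ω := by
    intro c h1 h2
    have hle : h (c - 1) + h (c + 1) ≤ᵐ[μ] (2 : ℝ) • h c := by
      filter_upwards [hh] with ω hω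
      simpa using hω c h1 h2
    filter_upwards [condExp_mono (m := m') ((hi (c - 1)).add (hi (c + 1))) ((hi c).smul (2 : ℝ)) hle,
      condExp_add (hi (c - 1)) (hi (c + 1)) m', condExp_smul (2 : ℝ) (h c) m'] with ω h3 h4 h5
    rw [h4, h5] at h3
    simpa using h3
  have key' : ∀ c : ℤ, ∀ᵐ ω ∂μ, -(m : ℤ) < c → c < N →
      (μ[h (c - 1) | m']) ω + (μ[h (c + 1) | m']) ω ≤ 2 * (μ[h c | m']) ω := by
    intro c
    by_cases h1 : -(m : ℤ) < c
    · by_cases h2 : c < N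
      · filter_upwards [key c h1 h2] with ω hω _ _ using hω
      · exact Filter.Eventually.of_forall fun ω _ h => absurd h h2
    · exact Filter.Eventually.of_forall fun ω h => absurd h h1
  filter_upwards [ae_all_iff.2 key'] with ω hω c h1 h2 using hω c h1 h2

theorem ae_concaveOnFeasible_value [IsFiniteMeasure μ] (hVm : ∀ k < n, Measurable[F k] (V k))
    (hVi : ∀ k < n, Integrable (V k) μ) {N : ℕ} (hN : N ≤ n) :
    ∀ᵐ ω ∂μ, ConcaveOnFeasible m N (fun c => value μ n F V m N c ω) := by
  induction N with
  | zero => exact Filter.Eventually.of_forall fun ω c _ _ => by simp [value]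
  | succ N ih =>
    filter_upwards [ae_concaveOnFeasible_condExp (m' := F (n - (N + 1)))
      (fun c => integrable_value hVm hVi (by lia) c) (ih (by lia))] with ω hω
    exact hω.stepValue

theorem ae_concaveOnFeasible_contValue [IsFiniteMeasure μ]
    (hVm : ∀ k < n, Measurable[F k] (V k)) (hVi : ∀ k < n, Integrable (V k) μ) (k : ℕ) :
    ∀ᵐ ω ∂μ, ConcaveOnFeasible m (n - (k + 1)) (contValue μ n F V m k ω) :=
  ae_concaveOnFeasible_condExp (fun c => integrable_value hVm hVi (by lia) c)
    (ae_concaveOnFeasible_value hVm hVi (by lia))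

/-- The residual lower constraint at date `k` under the control `q`, starting from `x`. -/
def residual (x : ℝ) (q : ℕ → Ω → ℝ) (k : ℕ) (ω : Ω) : ℝ :=
  x - ∑ j ∈ Finset.range k, q j ω

/-- The gain accumulated before date `k` under the control `q`, plus the value of the residual
constraint at date `k`. -/
noncomputable def gainProcess (μ : Measure Ω) (n : ℕ) (F : Filtration ℕ mΩ) (V : ℕ → Ω → ℝ)
    (m : ℕ) (x : ℝ) (q : ℕ → Ω → ℝ) (k : ℕ) (ω : Ω) : ℝ :=
  ∑ j ∈ Finset.range k, q j ω * V j ω +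
    interp (fun c => value μ n F V m (n - k) c ω) (residual x q k ω)

theorem residual_succ (x : ℝ) (q : ℕ → Ω → ℝ) (k : ℕ) (ω : Ω) :
    residual x q (k + 1) ω = residual x q k ω - q k ω := by
  rw [residual, residual, Finset.sum_range_succ]; ring

theorem measurable_residual {q : ℕ → Ω → ℝ} (x : ℝ) (hq : IsLocallyAdmissible n F q) {k l : ℕ}
    (hk : k ≤ n) (hkl : k ≤ l + 1) : Measurable[F l] (residual x q k) :=
  measurable_const.sub (Finset.measurable_fun_sum _ fun j hj => by
    have hj := Finset.mem_range.1 hj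
    exact (hq j (by lia)).1.mono (F.mono (by lia)) le_rfl)

theorem IsAdmissible.residual_mem {Q : ℝ × ℝ} {q : ℕ → Ω → ℝ} (hq : IsAdmissible n F Q q)
    (hm : Q.2 - Q.1 = m) {k : ℕ} (hk : k ≤ n) (ω : Ω) :
    -(m : ℝ) ≤ residual Q.1 q k ω ∧ residual Q.1 q k ω ≤ (n - k : ℕ) := by
  obtain ⟨h1, h2⟩ := hq.2 ω
  rw [← Finset.sum_range_add_sum_Ico _ hk] at h1 h2
  have h3 : 0 ≤ ∑ j ∈ Finset.Ico k n, q j ω := Finset.sum_nonneg fun j hj =>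
    ((hq.1 j (Finset.mem_Ico.1 hj).2).2 ω).1
  have h4 : ∑ j ∈ Finset.Ico k n, q j ω ≤ (n - k : ℕ) := by
    have := Finset.sum_le_card_nsmul (Finset.Ico k n) (fun j => q j ω) 1 fun j hj =>
      ((hq.1 j (Finset.mem_Ico.1 hj).2).2 ω).2
    simpa using this
  constructor <;> rw [residual] <;> linarith

theorem integrable_control_mul {q : ℕ → Ω → ℝ} (hq : IsLocallyAdmissible n F q)
    (hVi : ∀ k < n, Integrable (V k) μ) {j : ℕ} (hj : j < n) :
    Integrable (fun ω => q j ω * V j ω) μ := by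
  refine (hVi j hj).bdd_mul (c := 1) ((hq j hj).1.mono (F.le j) le_rfl).aestronglyMeasurable
    (Filter.Eventually.of_forall fun ω => ?_)
  obtain ⟨h0, h1⟩ := (hq j hj).2 ω
  rwa [Real.norm_of_nonneg h0]

theorem gainProcess_eq {q : ℕ → Ω → ℝ} {k : ℕ} (hk : k < n) (x : ℝ) (ω : Ω) :
    gainProcess μ n F V m x q k ω = ∑ j ∈ Finset.range k, q j ω * V j ω +
      interp (stepValue m (n - (k + 1)) (V k ω) (contValue μ n F V m k ω))
        (residual x q k ω) := by
  rw [gainProcess]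
  congr 2
  funext c
  exact value_sub hk c ω

theorem gain_eq_condExp_gainProcess {q : ℕ → Ω → ℝ} (x : ℝ) :
    gain μ n F V q = μ[gainProcess μ n F V m x q n | F 0] := by
  rw [gain]
  congr 1
  funext ω
  simp [gainProcess, value, interp]

theorem gainProcess_zero {q : ℕ → Ω → ℝ} (x : ℝ) :
    gainProcess μ n F V m x q 0 = fun ω => interp (fun c => value μ n F V m n c ω) x := by
  funext ω
  simp [gainProcess, residual]

section Verification

variable [IsFiniteMeasure μ] {Q : ℝ × ℝ} {q : ℕ → Ω → ℝ}

theorem integrable_gainProcess (hVm : ∀ k < n, Measurable[F k] (V k))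
    (hVi : ∀ k < n, Integrable (V k) μ) (hq : IsAdmissible n F Q q) (hm : Q.2 - Q.1 = m)
    {k : ℕ} (hk : k ≤ n) : Integrable (gainProcess μ n F V m Q.1 q k) μ := by
  refine Integrable.add (integrable_finsetSum _ fun j hj =>
    integrable_control_mul hq.1 hVi ((Finset.mem_range.1 hj).trans_le hk)) ?_
  exact integrable_interp (A := -(m : ℤ)) (B := (n - k : ℕ))
    (fun c => integrable_value hVm hVi (by lia) c)
    ((measurable_residual (l := k) Q.1 hq.1 hk (by lia)).mono (F.le k) le_rfl)
    (fun ω => by simpa using (hq.residual_mem hm hk ω).1)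
    (fun ω => by simpa only [Int.cast_natCast] using (hq.residual_mem hm hk ω).2)

theorem condExp_gainProcess_succ (hVm : ∀ k < n, Measurable[F k] (V k))
    (hVi : ∀ k < n, Integrable (V k) μ) (hq : IsAdmissible n F Q q) (hm : Q.2 - Q.1 = m)
    {k : ℕ} (hk : k < n) :
    μ[gainProcess μ n F V m Q.1 q (k + 1) | F k] =ᵐ[μ] fun ω =>
      ∑ j ∈ Finset.range k, q j ω * V j ω + (q k ω * V k ω +
        interp (contValue μ n F V m k ω) (residual Q.1 q k ω - q k ω)) := by
  have hS : Integrable (fun ω => ∑ j ∈ Finset.range (k + 1), q j ω * V j ω) μ :=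
    integrable_finsetSum _ fun j hj =>
      integrable_control_mul hq.1 hVi (by have := Finset.mem_range.1 hj; lia)
  have hSm : Measurable[F k] (fun ω => ∑ j ∈ Finset.range (k + 1), q j ω * V j ω) :=
    Finset.measurable_fun_sum _ fun j hj => by
      have hj := Finset.mem_range.1 hj
      exact ((hq.1 j (by lia)).1.mul (hVm j (by lia))).mono (F.mono (by lia)) le_rfl
  have hX := measurable_residual (F := F) (l := k) Q.1 hq.1 (by lia : k + 1 ≤ n) le_rfl
  have hA : ∀ ω, ((-(m : ℤ) : ℤ) : ℝ) ≤ residual Q.1 q (k + 1) ω := fun ω => by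
    simpa using (hq.residual_mem hm (by lia : k + 1 ≤ n) ω).1
  have hB : ∀ ω, residual Q.1 q (k + 1) ω ≤ ((n - (k + 1) : ℕ) : ℤ) := fun ω => by
    simpa only [Int.cast_natCast] using (hq.residual_mem hm (by lia : k + 1 ≤ n) ω).2
  have hv : ∀ c, Integrable (value μ n F V m (n - (k + 1)) c) μ :=
    fun c => integrable_value hVm hVi (by lia) c
  filter_upwards [condExp_add hS
    (integrable_interp hv (hX.mono (F.le k) le_rfl) hA hB) (F k),
    condExp_interp (F.le k) hv hX hA hB] with ω h1 h2
  refine h1.trans ?_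
  rw [Pi.add_apply, h2, condExp_of_stronglyMeasurable (F.le k) hSm.stronglyMeasurable hS]
  beta_reduce
  rw [Finset.sum_range_succ, residual_succ, add_assoc]
  rfl

/-- The gain of an admissible control is at most the initial value, because `gainProcess` is a
supermartingale. -/
theorem IsAdmissible.gain_le (hVm : ∀ k < n, Measurable[F k] (V k))
    (hVi : ∀ k < n, Integrable (V k) μ) (hq : IsAdmissible n F Q q) (hm : Q.2 - Q.1 = m) :
    gain μ n F V q ≤ᵐ[μ] μ[fun ω => interp (fun c => value μ n F V m n c ω) Q.1 | F 0] := by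
  have key : ∀ k ≤ n, μ[gainProcess μ n F V m Q.1 q k | F 0] ≤ᵐ[μ]
      μ[gainProcess μ n F V m Q.1 q 0 | F 0] := by
    intro k
    induction k with
    | zero => exact fun _ => Filter.EventuallyLE.refl _ _
    | succ k ih =>
      intro hk
      refine Filter.EventuallyLE.trans ?_ (ih (by lia))
      refine (condExp_condExp_of_le (F.mono k.zero_le) (F.le k)).symm.le.trans ?_
      refine condExp_mono integrable_condExp
        (integrable_gainProcess hVm hVi hq hm (by lia)) ?_
      filter_upwards [condExp_gainProcess_succ hVm hVi hq hm hk] with ω hω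
      obtain ⟨h0, h1⟩ := (hq.1 k hk).2 ω
      have hr := hq.residual_mem hm hk ω
      rw [residual_succ] at hr
      rw [hω, gainProcess_eq hk]
      gcongr
      exact mul_add_interp_le h0 h1 hr.1 hr.2
  rw [gain_eq_condExp_gainProcess (m := m) Q.1, ← gainProcess_zero (q := q)]
  exact key n le_rfl

/-- An admissible control that follows the feedback rule attains the initial value, because
`gainProcess` is then a martingale. -/
theorem IsAdmissible.gain_eq_of_feedback (hVm : ∀ k < n, Measurable[F k] (V k))
    (hVi : ∀ k < n, Integrable (V k) μ) (hq : IsAdmissible n F Q q) (hm : Q.2 - Q.1 = m)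
    (hfb : ∀ k < n, ∀ ω, q k ω =
      feedback m (n - (k + 1)) (V k ω) (contValue μ n F V m k ω) (residual Q.1 q k ω)) :
    gain μ n F V q =ᵐ[μ] μ[fun ω => interp (fun c => value μ n F V m n c ω) Q.1 | F 0] := by
  have key : ∀ k ≤ n, μ[gainProcess μ n F V m Q.1 q k | F 0] =ᵐ[μ]
      μ[gainProcess μ n F V m Q.1 q 0 | F 0] := by
    intro k
    induction k with
    | zero => exact fun _ => Filter.EventuallyEq.rfl
    | succ k ih =>
      intro hk
      refine Filter.EventuallyEq.trans ?_ (ih (by lia))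
      refine (condExp_condExp_of_le (F.mono k.zero_le) (F.le k)).symm.trans ?_
      refine condExp_congr_ae ?_
      filter_upwards [condExp_gainProcess_succ hVm hVi hq hm hk,
        ae_concaveOnFeasible_contValue hVm hVi k] with ω hω hc
      have hr := (hq.residual_mem hm (by lia : k ≤ n) ω).2
      have hN : ((n - k : ℕ) : ℝ) = (n - (k + 1) : ℕ) + 1 := by
        rw [show n - k = (n - (k + 1)) + 1 by lia]; push_cast; rfl
      rw [hω, gainProcess_eq hk, hfb k hk ω, hc.feedback_mul_add_interp (by rwa [← hN])]
  rw [gain_eq_condExp_gainProcess (m := m) Q.1, ← gainProcess_zero (q := q)]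
  exact key n le_rfl

end Verification

/-! ### The feedback control -/

/-- The residual constraint when the feedback rule is followed. -/
noncomputable def optResidual (μ : Measure Ω) (n : ℕ) (F : Filtration ℕ mΩ) (V : ℕ → Ω → ℝ)
    (m : ℕ) (x : ℝ) : ℕ → Ω → ℝ
  | 0, _ => x
  | k + 1, ω => optResidual μ n F V m x k ω - feedback m (n - (k + 1)) (V k ω)
      (contValue μ n F V m k ω) (optResidual μ n F V m x k ω)

/-- The control given by the feedback rule. -/
noncomputable def optControl (μ : Measure Ω) (n : ℕ) (F : Filtration ℕ mΩ) (V : ℕ → Ω → ℝ)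
    (m : ℕ) (x : ℝ) (k : ℕ) (ω : Ω) : ℝ :=
  feedback m (n - (k + 1)) (V k ω) (contValue μ n F V m k ω) (optResidual μ n F V m x k ω)

theorem residual_optControl (x : ℝ) (k : ℕ) (ω : Ω) :
    residual x (optControl μ n F V m x) k ω = optResidual μ n F V m x k ω := by
  induction k with
  | zero => simp [residual, optResidual]
  | succ k ih => rw [residual_succ, ih]; rfl

theorem optResidual_mem {x : ℝ} (hx1 : -(m : ℝ) ≤ x) (hx2 : x ≤ n) {k : ℕ} (hk : k ≤ n) (ω : Ω) :
    -(m : ℝ) ≤ optResidual μ n F V m x k ω ∧ optResidual μ n F V m x k ω ≤ (n - k : ℕ) := by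
  induction k with
  | zero => exact ⟨hx1, by simpa [optResidual] using hx2⟩
  | succ k ih =>
    obtain ⟨h1, h2⟩ := ih (by lia)
    have hN : ((n - k : ℕ) : ℝ) = (n - (k + 1) : ℕ) + 1 := by
      rw [show n - k = (n - (k + 1)) + 1 by lia]; push_cast; rfl
    exact sub_feedback_mem h1 (by rwa [← hN])

theorem measurable_optControl (hVm : ∀ k < n, Measurable[F k] (V k)) {x : ℝ}
    (hx1 : -(m : ℝ) ≤ x) (hx2 : x ≤ n) {k : ℕ} (hk : k < n) :
    Measurable[F k] (optResidual μ n F V m x k) ∧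
      Measurable[F k] (optControl μ n F V m x k) := by
  have aux : ∀ k < n, Measurable[F k] (optResidual μ n F V m x k) →
      Measurable[F k] (optControl μ n F V m x k) := fun k hk hX =>
    measurable_interp (A := -(m : ℤ)) (B := (n - k : ℕ))
      (fun c => measurable_purchase (hVm k hk) (measurable_contValue k) c) hX
      (fun ω => by simpa using (optResidual_mem hx1 hx2 hk.le ω).1)
      (fun ω => by simpa only [Int.cast_natCast] using (optResidual_mem hx1 hx2 hk.le ω).2)
  induction k with
  | zero => exact ⟨measurable_const, aux 0 hk measurable_const⟩
  | succ k ih =>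
    obtain ⟨h1, h2⟩ := ih (by lia)
    have h3 : Measurable[F (k + 1)] (optResidual μ n F V m x (k + 1)) :=
      (h1.sub h2).mono (F.mono k.le_succ) le_rfl
    exact ⟨h3, aux _ hk h3⟩

theorem isAdmissible_optControl (hVm : ∀ k < n, Measurable[F k] (V k)) {Q : ℝ × ℝ}
    (hQ : Q ∈ globalConstraints n) (hm : Q.2 - Q.1 = m) :
    IsAdmissible n F Q (optControl μ n F V m Q.1) := by
  obtain ⟨h0, h1, h2⟩ := hQ
  have hx1 : -(m : ℝ) ≤ Q.1 := by linarith
  have hx2 : Q.1 ≤ n := h1.trans h2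
  refine ⟨fun k hk => ⟨(measurable_optControl hVm hx1 hx2 hk).2, fun ω => feedback_mem_Icc _⟩,
    fun ω => ?_⟩
  obtain ⟨h3, h4⟩ := optResidual_mem (μ := μ) (F := F) (V := V) hx1 hx2 (le_refl n) ω
  rw [← residual_optControl, residual] at h3 h4
  rw [Nat.sub_self, Nat.cast_zero] at h4
  constructor <;> linarith

theorem isQuasiBangBang_optControl [IsFiniteMeasure μ] (hVm : ∀ k < n, Measurable[F k] (V k))
    (hVi : ∀ k < n, Integrable (V k) μ) {x : ℝ} (hx1 : -(m : ℝ) ≤ x) (hx2 : x ≤ n) :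
    IsQuasiBangBang μ n (optControl μ n F V m x) := by
  filter_upwards [ae_all_iff.2 fun k =>
    ae_concaveOnFeasible_contValue (m := m) hVm hVi k] with ω hc
  -- integer residual constraints stay integer, hence are followed by purchases in `{0, 1}` only
  have hint : ∀ k l, k ≤ l → (∃ b : ℤ, optResidual μ n F V m x k ω = b) →
      ∃ b : ℤ, optResidual μ n F V m x l ω = b := by
    intro k l hkl hk
    induction l, hkl using Nat.le_induction with
    | base => exact hk
    | succ l _ ih =>
      obtain ⟨b, hb⟩ := ih
      rw [optResidual, hb]
      exact exists_intCast_sub_feedback b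
  have hlt : ∀ k l, k < l → k < n → optControl μ n F V m x k ω ∉ ({0, 1} : Set ℝ) →
      optControl μ n F V m x l ω ∈ ({0, 1} : Set ℝ) := by
    intro k l hkl hk hfrac
    have hN : ((n - k : ℕ) : ℝ) = (n - (k + 1) : ℕ) + 1 := by
      rw [show n - k = (n - (k + 1)) + 1 by lia]; push_cast; rfl
    have hr := (optResidual_mem (μ := μ) (F := F) (V := V) hx1 hx2 hk.le ω).2
    rw [hN] at hr
    obtain ⟨b, hb⟩ := hint (k + 1) l hkl ((hc k).exists_intCast_of_feedback_notMem hr hfrac)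
    rw [optControl, hb]
    exact feedback_intCast_mem b
  rintro k ⟨hk, hk'⟩ l ⟨hl, hl'⟩
  rcases lt_trichotomy k l with h | h | h
  · exact absurd (hlt k l h hk hk') hl'
  · exact h
  · exact absurd (hlt l k h hl hl') hk'

end SwingOption

theorem mainTheorem4 {Ω : Type*} {mΩ : MeasurableSpace Ω} (μ : Measure Ω)
    [IsProbabilityMeasure μ] (n : ℕ) (hn : 1 ≤ n) (F : Filtration ℕ mΩ) (V : ℕ → Ω → ℝ)
    (hV_adapted : ∀ k < n, Measurable[F k] (V k))
    (hV_integrable : ∀ k < n, Integrable (V k) μ)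
    (Q : ℝ × ℝ) (hQ : Q ∈ SwingOption.globalConstraints n)
    (hQ_diff : ∃ m : ℕ, m ≤ n ∧ Q.2 - Q.1 = (m : ℝ)) :
    ∃ q : ℕ → Ω → ℝ,
      SwingOption.IsOptimal μ n F V Q q ∧ SwingOption.IsQuasiBangBang μ n q := by
  obtain ⟨m, -, hm⟩ := hQ_diff
  have hadm := SwingOption.isAdmissible_optControl (μ := μ) hV_adapted hQ hm
  refine ⟨SwingOption.optControl μ n F V m Q.1, ⟨hadm, ?_, ?_, fun h _ hh => hh _ ⟨_, hadm, rfl⟩⟩,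
    SwingOption.isQuasiBangBang_optControl hV_adapted hV_integrable
      (by linarith [hQ.1, (m.cast_nonneg : (0 : ℝ) ≤ m)]) (hQ.2.1.trans hQ.2.2)⟩
  · exact ((stronglyMeasurable_condExp.measurable.mono (F.le 0) le_rfl).coe_real_ereal).aemeasurable
  · rintro _ ⟨q, hq, rfl⟩
    filter_upwards [hq.gain_le hV_adapted hV_integrable hm,
      hadm.gain_eq_of_feedback hV_adapted hV_integrable hm
        fun k _ ω => by rw [SwingOption.residual_optControl]; rfl] with ω h1 h2
    rw [← h2] at h1
    exact_mod_cast h1
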